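/- Let $\gamma_1,\dots,\gamma_d\in\mathbb R^d$ be linearly independent and let $\mathcal R=\gamma_1\mathbb Z\oplus\cdots\oplus\gamma_d\mathbb Z$. Let $C_p^0(\mathbb R)$ be the class of functions $f:\mathbb R\to\mathbb C$ that have only finitely many discontinuities on every bounded interval and are locally integrable, and let $C_p^{l+1}(\mathbb R)$ be the class of functions that are differentiable with derivative in $C_p^{l}(\mathbb R)$. Here "$f$ is differentiable with derivative $g$" may be read in either of two ways, the same one throughout: (a) $f'(t)=g(t)$ for every $t\in\mathbb R$; or (b) $f$ is continuous and $f'(t)=g(t)$ at every point $t$ at which $g$ is continuous. Let $C_{p,T}^{l}(\mathbb R)$ be the class of $T$-periodic functions in $C_p^l(\mathbb R)$. A function $f:\mathbb R^d\to\mathbb C$ belongs to $\bigotimes_{j=1}^d C_p^l(\mathbb R)$ if for every $j$ and every $\mathbf r\in\mathbb R^d$ the function $t\mapsto f(\mathbf r+t\gamma_j)$ belongs to $C_p^l(\mathbb R)$. For $T>0$ and $k\in\mathbb C$ put $[k]_T=\{k+\frac{2m\pi}{T}: m\in\mathbb Z\}$. **Theorem.** Let $V:\mathbb R^d\to\mathbb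 C$ be $\mathcal R$-periodic with $V\in\bigotimes_{j=1}^d C_p^0(\mathbb R)$, let $\lambda\in\mathbb C$, and let $\Psi\in\bigotimes_{j=1}^d C_p^2(\mathbb R)$, $\Psi\not\equiv 0$, satisfy $$-\tfrac12\Delta\Psi+V\Psi=\lambda\Psi$$ at almost every point of $\mathbb R^d$ (for instance, at every point). Suppose that $\Psi$ is separable in the coordinates along the primitive vectors: there are functions $\psi_1,\dots,\psi_d:\mathbb R\to\mathbb C$ with $$\Psi\Big(\sum_{j=1}^d \tilde x_j\,\frac{\gamma_j}{\|\gamma_j\|}\Big)=\prod_{j=1}^d\psi_j(\tilde x_j)\qquad\text{for all }(\tilde x_1,\dots,\tilde x_d)\in\mathbb R^d .$$ Then for each $j=1,\dots,d$ the function $\psi_j$ is of one of the following three forms (for all $t\in\mathbb R$): 1. $\psi_j(t)=e^{\mathrm i k_j t}p_j(t)$ with $k_j\in\mathbb C$ and $p_j\in C^2_{p,\|\gamma_j\|}(\mathbb R)$; 2. $\psi_j(t)=e^{\mathrm i k_j t}\big(p_j^{(1)}(t)+t\,p_j^{(2)}(t)\big)$ with $k_j\in\mathbb C$, $p_j^{(1)},p_j^{(2)}\in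 C^2_{p,\|\gamma_j\|}(\mathbb R)$ and $p_j^{(2)}\not\equiv0$; 3. $\psi_j(t)=e^{\mathrm i k_j^{(1)} t}p_j^{(1)}(t)+e^{\mathrm i k_j^{(2)} t}p_j^{(2)}(t)$ with $k_j^{(1)},k_j^{(2)}\in\mathbb C$, $[k_j^{(1)}]_{\|\gamma_j\|}\ne[k_j^{(2)}]_{\|\gamma_j\|}$ and $p_j^{(1)},p_j^{(2)}\in C^2_{p,\|\gamma_j\|}(\mathbb R)$. -/

import Mathlib

open MeasureTheory
open scoped Laplacian

/-- Finitely many discontinuity points on any bounded interval. -/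
def IsPiecewiseContinuous (f : ℝ → ℂ) : Prop :=
  ∀ a b : ℝ, {t : ℝ | t ∈ Set.Icc a b ∧ ¬ ContinuousAt f t}.Finite

/-- The two usual conventions for "`f` is differentiable with piecewise-continuous derivative `g`":
the derivative exists at every point, or it exists away from the discontinuities of `g`, across
which `f` is only required to be continuous (as for classical solutions of equations with
discontinuous coefficients). -/
inductive DerivSense where
  | everywhere
  | piecewise

/-- `g` is the derivative of `f` on the real line, under the chosen convention. -/
def IsDerivative : DerivSense → (ℝ → ℂ) → (ℝ → ℂ) → Prop
  | .everywhere, f, g => ∀ t : ℝ, HasDerivAt f (g t) t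
  | .piecewise, f, g => Continuous f ∧ ∀ t : ℝ, ContinuousAt g t → HasDerivAt f (g t) t

/-- The class `C_p^l(ℝ)`: `C_p^0(ℝ)` consists of the piecewise-continuous functions that are
integrable near each (discontinuity) point, and `C_p^{l+1}(ℝ)` of the functions that are
differentiable with derivative in `C_p^l(ℝ)`. -/
def MemCp (s : DerivSense) : ℕ → (ℝ → ℂ) → Prop
  | 0, f => IsPiecewiseContinuous f ∧ LocallyIntegrable f volume
  | l + 1, f => ∃ g : ℝ → ℂ, IsDerivative s f g ∧ MemCp s l g

/-- The class `C_{p,T}^l(ℝ)` of the functions in `C_p^l(ℝ)` with period `T`. -/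
def MemCpPeriodic (s : DerivSense) (T : ℝ) (l : ℕ) (f : ℝ → ℂ) : Prop :=
  MemCp s l f ∧ Function.Periodic f T

/-- The Bravais lattice `γ₁ℤ ⊕ ⋯ ⊕ γ_dℤ`. -/
def bravaisLattice {d : ℕ} (γ : Fin d → EuclideanSpace ℝ (Fin d)) :
    Submodule ℤ (EuclideanSpace ℝ (Fin d)) :=
  Submodule.span ℤ (Set.range γ)

/-- `f` is periodic with respect to the Bravais lattice of `γ`. -/
def IsLatticePeriodic {d : ℕ} (γ : Fin d → EuclideanSpace ℝ (Fin d))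
    (f : EuclideanSpace ℝ (Fin d) → ℂ) : Prop :=
  ∀ a ∈ bravaisLattice γ, ∀ r : EuclideanSpace ℝ (Fin d), f (r + a) = f r

/-- The class `⨂_j C_p^l(ℝ)`: `f` is in `C_p^l(ℝ)` along every line parallel to some `γ_j`. -/
def MemTensorCp {d : ℕ} (γ : Fin d → EuclideanSpace ℝ (Fin d)) (s : DerivSense) (l : ℕ)
    (f : EuclideanSpace ℝ (Fin d) → ℂ) : Prop :=
  ∀ (j : Fin d) (r : EuclideanSpace ℝ (Fin d)), MemCp s l (fun t : ℝ => f (r + t • γ j))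

/-- The point with coordinates `x` along the normalized primitive vectors:
`r = ∑_j x_j γ_j / ‖γ_j‖`. -/
noncomputable def ofLatticeCoords {d : ℕ} (γ : Fin d → EuclideanSpace ℝ (Fin d))
    (x : Fin d → ℝ) : EuclideanSpace ℝ (Fin d) :=
  ∑ j, x j • (‖γ j‖⁻¹ • γ j)

/-- `Ψ` is the product of the one-variable functions `ψ_j` of the coordinates along `γ_j`. -/
def IsSeparatedBy {d : ℕ} (γ : Fin d → EuclideanSpace ℝ (Fin d))
    (Ψ : EuclideanSpace ℝ (Fin d) → ℂ) (ψ : Fin d → ℝ → ℂ) : Prop :=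
  ∀ x : Fin d → ℝ, Ψ (ofLatticeCoords γ x) = ∏ j, ψ j (x j)

/-- `Ψ` solves `-½ ΔΨ + VΨ = EΨ` at almost every point. -/
def IsSchrodingerSolution {d : ℕ} (V : EuclideanSpace ℝ (Fin d) → ℂ) (E : ℂ)
    (Ψ : EuclideanSpace ℝ (Fin d) → ℂ) : Prop :=
  ∀ᵐ r ∂(volume : Measure (EuclideanSpace ℝ (Fin d))),
    -(1 / 2 : ℂ) * (Δ Ψ) r + V r * Ψ r = E * Ψ r

/-- The class `[k]_T = {k + 2mπ/T : m ∈ ℤ}` of a quasimomentum. -/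
def quasimomentumClass (T : ℝ) (k : ℂ) : Set ℂ :=
  {z : ℂ | ∃ m : ℤ, z = k + 2 * (m : ℂ) * (Real.pi : ℂ) / (T : ℂ)}

/-- Bloch form: `e^{ikt} p(t)` with `p` of period `T`. -/
def IsBlochForm (s : DerivSense) (T : ℝ) (f : ℝ → ℂ) : Prop :=
  ∃ (k : ℂ) (p : ℝ → ℂ), MemCpPeriodic s T 2 p ∧
    ∀ t : ℝ, f t = Complex.exp (Complex.I * k * (t : ℂ)) * p t

/-- Bloch form with linear growth: `e^{ikt} (p₁(t) + t p₂(t))` with `p₁`, `p₂` of period `T` and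
`p₂` not identically zero. -/
def IsGrowthForm (s : DerivSense) (T : ℝ) (f : ℝ → ℂ) : Prop :=
  ∃ (k : ℂ) (p₁ p₂ : ℝ → ℂ), MemCpPeriodic s T 2 p₁ ∧ MemCpPeriodic s T 2 p₂ ∧ p₂ ≠ 0 ∧
    ∀ t : ℝ, f t = Complex.exp (Complex.I * k * (t : ℂ)) * (p₁ t + (t : ℂ) * p₂ t)

/-- Sum of two Bloch functions with distinct quasimomentum classes. -/
def IsTwoBlochForm (s : DerivSense) (T : ℝ) (f : ℝ → ℂ) : Prop :=
  ∃ (k₁ k₂ : ℂ) (p₁ p₂ : ℝ → ℂ), quasimomentumClass T k₁ ≠ quasimomentumClass T k₂ ∧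
    MemCpPeriodic s T 2 p₁ ∧ MemCpPeriodic s T 2 p₂ ∧
    ∀ t : ℝ, f t = Complex.exp (Complex.I * k₁ * (t : ℂ)) * p₁ t +
      Complex.exp (Complex.I * k₂ * (t : ℂ)) * p₂ t

/-! Fix `j`, let `l` be the coordinate along the unit vector `e` parallel to `γ j`, and write `Ψ = ψ
j (l r) * G r`, where `G` collects the other factors and is invariant under translation along `e`.
On a line parallel to `e` the values of `G` and of its first two derivatives are therefore constant,
so wherever the equation holds on that line it reads `G α ψ'' + 2 κ ψ' + δ ψ = 2 (V - E) G ψ` with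
constants `G`, `α`, `κ`, `δ`. The first-order term is the price of oblique coordinates. By Fubini
some line on which `G ≠ 0` carries the equation almost everywhere, and `α`, the squared norm of the
functional `l`, is positive. Hence `ψ j` solves `f'' = b f' + q f` with `b` constant and `q` locally
integrable and `‖γ j‖`-periodic (`IsSeparatedBy.exists_isODESolution`).

The rest is Floquet theory. Translation by the period preserves solutions, and a solution is
determined by its value and slope at one point (`IsODESolution.eq_zero`); so `f` satisfies a
two-step recursion under translation (`IsODESolution.exists_recursion`). Factoring its
characteristic polynomial gives the three forms (`floquet_forms`). -/

/-! ### Locally finite sets and the calculus of `C_p^2`. -/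

theorem locallyIntegrable_iff_intervalIntegrable (f : ℝ → ℂ) :
    LocallyIntegrable f volume ↔ ∀ a b : ℝ, IntervalIntegrable f volume a b := by
  constructor
  · intro h a b
    exact (h.integrableOn_isCompact isCompact_uIcc).intervalIntegrable
  · intro h x
    refine ⟨Set.Ioc (x - 1) (x + 1), Ioc_mem_nhds (by linarith) (by linarith), ?_⟩
    exact (intervalIntegrable_iff_integrableOn_Ioc_of_le (by linarith)).1 (h _ _)

theorem MeasureTheory.LocallyIntegrable.comp_affine {f : ℝ → ℂ}
    (hf : LocallyIntegrable f volume) {c : ℝ} (hc : c ≠ 0) (a : ℝ) :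
    LocallyIntegrable (fun t => f (c * t + a)) volume := by
  rw [locallyIntegrable_iff_intervalIntegrable] at hf ⊢
  intro u v
  have h1 := (hf (c * u + a) (c * v + a)).comp_add_right a
  have h2 := h1.comp_mul_left (c := c)
  simpa [hc] using h2

/-- A set of reals meeting every bounded interval in a finite set. -/
def IsLocallyFiniteSet (D : Set ℝ) : Prop := ∀ a b : ℝ, (Set.Icc a b ∩ D).Finite

theorem IsLocallyFiniteSet.union {D D' : Set ℝ} (h : IsLocallyFiniteSet D)
    (h' : IsLocallyFiniteSet D') : IsLocallyFiniteSet (D ∪ D') := fun a b => by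
  rw [Set.inter_union_distrib_left]
  exact (h a b).union (h' a b)

theorem IsLocallyFiniteSet.mono {D D' : Set ℝ} (h : IsLocallyFiniteSet D') (hD : D ⊆ D') :
    IsLocallyFiniteSet D := fun a b => (h a b).subset (Set.inter_subset_inter_right _ hD)

theorem IsLocallyFiniteSet.countable {D : Set ℝ} (h : IsLocallyFiniteSet D) : D.Countable := by
  have : D = ⋃ n : ℕ, Set.Icc (-(n : ℝ)) n ∩ D := by
    ext x
    simp only [Set.mem_iUnion, Set.mem_inter_iff, Set.mem_Icc]
    constructor
    · intro hx
      obtain ⟨n, hn⟩ := exists_nat_ge |x|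
      exact ⟨n, ⟨by linarith [neg_abs_le x], by linarith [le_abs_self x]⟩, hx⟩
    · rintro ⟨n, -, hx⟩
      exact hx
  rw [this]
  exact Set.countable_iUnion fun n => (h _ _).countable

theorem IsLocallyFiniteSet.preimage_affine {D : Set ℝ} (h : IsLocallyFiniteSet D) {c : ℝ}
    (hc : c ≠ 0) (a : ℝ) : IsLocallyFiniteSet ((fun t => c * t + a) ⁻¹' D) := by
  intro u v
  have hinj : Function.Injective fun t : ℝ => c * t + a := fun x y hxy => by
    simpa [hc] using hxy
  have hmono : ∀ t ∈ Set.Icc u v, c * t + a ∈ Set.Icc (-(|c| * (|u| + |v|)) + a)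
      (|c| * (|u| + |v|) + a) := by
    intro t ht
    have h1 : |t| ≤ |u| + |v| := by
      rw [abs_le]
      constructor
      · linarith [neg_abs_le u, abs_nonneg v, ht.1]
      · linarith [le_abs_self v, abs_nonneg u, ht.2]
    have h2 : |c * t| ≤ |c| * (|u| + |v|) := by
      rw [abs_mul]
      gcongr
    rw [abs_le] at h2
    exact ⟨by linarith, by linarith⟩
  refine ((h (-(|c| * (|u| + |v|)) + a) (|c| * (|u| + |v|) + a)).preimage hinj.injOn).subset ?_
  rintro t ⟨ht, htD⟩
  exact ⟨hmono t ht, htD⟩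

/-- Piecewise continuity in terms of the set of discontinuities. -/
theorem isPiecewiseContinuous_iff {h : ℝ → ℂ} :
    IsPiecewiseContinuous h ↔ IsLocallyFiniteSet {t | ¬ ContinuousAt h t} := Iff.rfl

theorem IsPiecewiseContinuous.of_subset {h : ℝ → ℂ} {D : Set ℝ} (hD : IsLocallyFiniteSet D)
    (hc : ∀ t ∉ D, ContinuousAt h t) : IsPiecewiseContinuous h :=
  hD.mono fun t ht => by
    by_contra hD'
    exact ht (hc t hD')

open Filter Topology in
theorem IsLocallyFiniteSet.eventually_notMem {D : Set ℝ} (hD : IsLocallyFiniteSet D) (t : ℝ) :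
    ∀ᶠ y in 𝓝[≠] t, y ∉ D := by
  have h1 : ((Set.Icc (t - 1) (t + 1) ∩ D) \ {t})ᶜ ∈ 𝓝 t :=
    ((hD (t - 1) (t + 1)).subset Set.sdiff_subset).isClosed.isOpen_compl.mem_nhds (by simp)
  have h2 : Set.Icc (t - 1) (t + 1) ∈ 𝓝 t := Icc_mem_nhds (by linarith) (by linarith)
  filter_upwards [mem_nhdsWithin_of_mem_nhds h1, mem_nhdsWithin_of_mem_nhds h2,
    self_mem_nhdsWithin] with y hy1 hy2 hy3 hyD
  exact hy1 ⟨⟨hy2, hyD⟩, hy3⟩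

open Filter Topology in
-- One-sided limits of the derivative of a continuous function are its one-sided derivatives. This
-- lets an arbitrary locally finite exceptional set replace the discontinuity set of `h` in the
-- piecewise reading.
theorem hasDerivAt_of_eventually_ne {g h : ℝ → ℂ} {t : ℝ}
    (hd : ∀ᶠ y in 𝓝[≠] t, HasDerivAt g (h y) y) (hg : ContinuousAt g t)
    (hh : ContinuousAt h t) : HasDerivAt g (h t) t := by
  have hR : ∀ᶠ y in 𝓝[>] t, HasDerivAt g (h y) y :=
    hd.filter_mono (nhdsWithin_mono _ fun y hy => (ne_of_gt hy))
  have hL : ∀ᶠ y in 𝓝[<] t, HasDerivAt g (h y) y :=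
    hd.filter_mono (nhdsWithin_mono _ fun y hy => (ne_of_lt hy))
  have A : HasDerivWithinAt g (h t) (Set.Ici t) t := by
    refine hasDerivWithinAt_Ici_of_tendsto_deriv (s := {y | HasDerivAt g (h y) y})
      (fun y hy => (HasDerivAt.differentiableAt hy).differentiableWithinAt)
      hg.continuousWithinAt hR ?_
    exact (hh.tendsto.mono_left nhdsWithin_le_nhds).congr' (hR.mono fun y hy => hy.deriv.symm)
  have B : HasDerivWithinAt g (h t) (Set.Iic t) t := by
    refine hasDerivWithinAt_Iic_of_tendsto_deriv (s := {y | HasDerivAt g (h y) y})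
      (fun y hy => (HasDerivAt.differentiableAt hy).differentiableWithinAt)
      hg.continuousWithinAt hL ?_
    exact (hh.tendsto.mono_left nhdsWithin_le_nhds).congr' (hL.mono fun y hy => hy.deriv.symm)
  simpa using B.union A

/-- For a piecewise-continuous `h`, both readings of "`g` has derivative `h`" say that `g` is
continuous and has derivative `h` off a locally finite exceptional set, which is empty under the
first reading. -/
theorem isDerivative_iff {s : DerivSense} {g h : ℝ → ℂ} (hh : IsPiecewiseContinuous h) :
    IsDerivative s g h ↔ Continuous g ∧ ∃ D : Set ℝ, IsLocallyFiniteSet D ∧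
      (s = .everywhere → D = ∅) ∧ ∀ t ∉ D, HasDerivAt g (h t) t := by
  cases s with
  | everywhere =>
    constructor
    · intro H
      exact ⟨continuous_iff_continuousAt.2 fun t => (H t).continuousAt, ∅,
        fun a b => by simp, fun _ => rfl, fun t _ => H t⟩
    · rintro ⟨-, D, -, hD, H⟩ t
      exact H t (by simp [hD rfl])
  | piecewise =>
    constructor
    · rintro ⟨hg, H⟩
      exact ⟨hg, _, isPiecewiseContinuous_iff.1 hh, by simp, fun t ht => H t (by simpa using ht)⟩
    · rintro ⟨hg, D, hD, -, H⟩
      refine ⟨hg, fun t ht => ?_⟩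
      exact hasDerivAt_of_eventually_ne ((hD.eventually_notMem t).mono fun y hy => H y hy)
        hg.continuousAt ht

/-- The data of a function of class `C_p^2`: its first two derivatives, with the locally finite
set off which the second one exists. -/
structure HasCpDerivs (s : DerivSense) (f g h : ℝ → ℂ) (D : Set ℝ) : Prop where
  hasDerivAt : ∀ t, HasDerivAt f (g t) t
  continuous_deriv : Continuous g
  locallyFinite : IsLocallyFiniteSet D
  eq_empty : s = .everywhere → D = ∅
  hasDerivAt_deriv : ∀ t ∉ D, HasDerivAt g (h t) t
  piecewiseContinuous : IsPiecewiseContinuous h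
  locallyIntegrable : LocallyIntegrable h volume

theorem HasCpDerivs.continuous {s : DerivSense} {f g h : ℝ → ℂ} {D : Set ℝ}
    (H : HasCpDerivs s f g h D) : Continuous f :=
  continuous_iff_continuousAt.2 fun t => (H.hasDerivAt t).continuousAt

/-- The first derivative is continuous, so under either reading it exists at every point; only the
second derivative can fail on `D`. -/
theorem memCp_two_iff {s : DerivSense} {f : ℝ → ℂ} :
    MemCp s 2 f ↔ ∃ g h D, HasCpDerivs s f g h D := by
  constructor
  · rintro ⟨g, hfg, h, hgh, hpc, hli⟩
    obtain ⟨hgc, D, hD, hDe, hd⟩ := (isDerivative_iff hpc).1 hgh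
    refine ⟨g, h, D, ?_, hgc, hD, hDe, hd, hpc, hli⟩
    cases s with
    | everywhere => exact hfg
    | piecewise => exact fun t => hfg.2 t hgc.continuousAt
  · rintro ⟨g, h, D, H⟩
    refine ⟨g, ?_, h, (isDerivative_iff H.piecewiseContinuous).2
      ⟨H.continuous_deriv, D, H.locallyFinite, H.eq_empty, H.hasDerivAt_deriv⟩,
      H.piecewiseContinuous, H.locallyIntegrable⟩
    cases s with
    | everywhere => exact H.hasDerivAt
    | piecewise => exact ⟨H.continuous, fun t _ => H.hasDerivAt t⟩

theorem MemCp.add_two {s : DerivSense} {f₁ f₂ : ℝ → ℂ} (h₁ : MemCp s 2 f₁) (h₂ : MemCp s 2 f₂) :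
    MemCp s 2 (fun t => f₁ t + f₂ t) := by
  rw [memCp_two_iff] at *
  obtain ⟨g₁, k₁, D₁, H₁⟩ := h₁
  obtain ⟨g₂, k₂, D₂, H₂⟩ := h₂
  refine ⟨fun t => g₁ t + g₂ t, fun t => k₁ t + k₂ t, D₁ ∪ D₂,
    fun t => (H₁.hasDerivAt t).add (H₂.hasDerivAt t), H₁.continuous_deriv.add H₂.continuous_deriv,
    H₁.locallyFinite.union H₂.locallyFinite,
    fun hs => by rw [H₁.eq_empty hs, H₂.eq_empty hs, Set.union_self], fun t ht => ?_, ?_,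
    H₁.locallyIntegrable.add H₂.locallyIntegrable⟩
  · rw [Set.mem_union, not_or] at ht
    exact (H₁.hasDerivAt_deriv t ht.1).add (H₂.hasDerivAt_deriv t ht.2)
  · refine .of_subset ((isPiecewiseContinuous_iff.1 H₁.piecewiseContinuous).union
      (isPiecewiseContinuous_iff.1 H₂.piecewiseContinuous)) fun t ht => ?_
    simp only [Set.mem_union, Set.mem_ofPred_eq, not_or, not_not] at ht
    exact ht.1.add ht.2

theorem MemCp.mul_two {s : DerivSense} {f e e' e'' : ℝ → ℂ} (hf : MemCp s 2 f)
    (he : ∀ t, HasDerivAt e (e' t) t) (he' : ∀ t, HasDerivAt e' (e'' t) t)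
    (hc : Continuous e'') : MemCp s 2 (fun t => e t * f t) := by
  rw [memCp_two_iff] at *
  obtain ⟨g, h, D, H⟩ := hf
  have ce : Continuous e := continuous_iff_continuousAt.2 fun t => (he t).continuousAt
  have ce' : Continuous e' := continuous_iff_continuousAt.2 fun t => (he' t).continuousAt
  have cg := H.continuous_deriv
  have cf := H.continuous
  refine ⟨fun t => e' t * f t + e t * g t,
    fun t => (e'' t * f t + e' t * g t) + (e' t * g t + e t * h t), D,
    fun t => (he t).mul (H.hasDerivAt t), by fun_prop, H.locallyFinite, H.eq_empty,
    fun t ht => ?_, ?_, ?_⟩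
  · exact ((he' t).mul (H.hasDerivAt t)).add ((he t).mul (H.hasDerivAt_deriv t ht))
  · refine .of_subset (isPiecewiseContinuous_iff.1 H.piecewiseContinuous) fun t ht => ?_
    simp only [Set.mem_ofPred_eq, not_not] at ht
    fun_prop
  · have h1 : Continuous fun t => e'' t * f t + e' t * g t := by fun_prop
    have h2 : Continuous fun t => e' t * g t := by fun_prop
    exact h1.locallyIntegrable.add
      (h2.locallyIntegrable.add (LocallyIntegrable.continuous_mul ce H.locallyIntegrable))

theorem MemCp.const_mul_two {s : DerivSense} {f : ℝ → ℂ} (hf : MemCp s 2 f) (c : ℂ) :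
    MemCp s 2 (fun t => c * f t) :=
  hf.mul_two (e := fun _ => c) (e' := fun _ => 0) (e'' := fun _ => 0)
    (fun t => hasDerivAt_const t c) (fun t => hasDerivAt_const t 0) continuous_const

theorem MemCp.ofReal_mul_two {s : DerivSense} {f : ℝ → ℂ} (hf : MemCp s 2 f) :
    MemCp s 2 (fun t => (t : ℂ) * f t) :=
  hf.mul_two (e := fun t => (t : ℂ)) (e' := fun _ => 1) (e'' := fun _ => 0)
    (fun _ => Complex.ofRealCLM.hasDerivAt) (fun t => hasDerivAt_const t 1) continuous_const

theorem MemCp.exp_mul_two {s : DerivSense} {f : ℝ → ℂ} (hf : MemCp s 2 f) (c : ℂ) :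
    MemCp s 2 (fun t => Complex.exp (c * t) * f t) := by
  have key : ∀ t : ℝ, HasDerivAt (fun t : ℝ => Complex.exp (c * t)) (Complex.exp (c * t) * c) t := by
    intro t
    have h := ((hasDerivAt_id (t : ℂ)).const_mul c).cexp.comp_ofReal
    simpa using h
  exact hf.mul_two key (fun t => (key t).mul_const c) (by fun_prop)

theorem MemCp.comp_affine_two {s : DerivSense} {f : ℝ → ℂ} (hf : MemCp s 2 f) {c : ℝ}
    (hc : c ≠ 0) (a : ℝ) : MemCp s 2 (fun t => f (c * t + a)) := by
  rw [memCp_two_iff] at *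
  obtain ⟨g, h, D, H⟩ := hf
  have hA : ∀ t : ℝ, HasDerivAt (fun t : ℝ => c * t + a) c t := fun t => by
    simpa using ((hasDerivAt_id t).const_mul c).add_const a
  have cA : Continuous fun t : ℝ => c * t + a := by fun_prop
  refine ⟨fun t => c • g (c * t + a), fun t => c • c • h (c * t + a),
    (fun t => c * t + a) ⁻¹' D, fun t => (H.hasDerivAt _).scomp t (hA t),
    (H.continuous_deriv.comp cA).const_smul c, H.locallyFinite.preimage_affine hc a,
    fun hs => by rw [H.eq_empty hs, Set.preimage_empty], fun t ht => ?_, ?_, ?_⟩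
  · exact ((H.hasDerivAt_deriv _ ht).scomp t (hA t)).const_smul c
  · refine .of_subset ((isPiecewiseContinuous_iff.1 H.piecewiseContinuous).preimage_affine hc a)
      fun t ht => ?_
    simp only [Set.mem_preimage, Set.mem_ofPred_eq, not_not] at ht
    have h1 : ContinuousAt (fun t => h (c * t + a)) t :=
      ContinuousAt.comp (f := fun t : ℝ => c * t + a) ht cA.continuousAt
    exact (h1.const_smul c).const_smul c
  · exact ((H.locallyIntegrable.comp_affine hc a).smul c).smul c

/-! ### Multipliers and Floquet normal forms. -/

theorem exists_exp_I_mul_eq {T : ℝ} (hT : 0 < T) {μ : ℂ} (hμ : μ ≠ 0) :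
    ∃ k : ℂ, Complex.exp (Complex.I * k * T) = μ := by
  have hT' : (T : ℂ) ≠ 0 := by exact_mod_cast hT.ne'
  refine ⟨-Complex.I * (Complex.log μ / T), ?_⟩
  have : Complex.I * (-Complex.I * (Complex.log μ / T)) * T = Complex.log μ := by
    have hI := Complex.I_mul_I
    field_simp
    linear_combination -Complex.log μ * hI
  rw [this, Complex.exp_log hμ]

/-- The factor `e^{-ikt}` divides the multiplier `e^{ikT}` out of a function. -/
theorem exists_periodic_factor {s : DerivSense} {T : ℝ} {f : ℝ → ℂ} (hf : MemCp s 2 f) {k μ : ℂ}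
    (hk : Complex.exp (Complex.I * k * T) = μ) (hμf : ∀ t, f (t + T) = μ * f t) :
    ∃ p, MemCpPeriodic s T 2 p ∧ ∀ t : ℝ, f t = Complex.exp (Complex.I * k * t) * p t := by
  refine ⟨fun t => Complex.exp (-(Complex.I * k) * t) * f t, ⟨hf.exp_mul_two _, fun t => ?_⟩,
    fun t => ?_⟩
  · have : Complex.exp (-(Complex.I * k) * (t + T : ℝ)) * μ = Complex.exp (-(Complex.I * k) * t) := by
      rw [← hk, ← Complex.exp_add]
      push_cast
      ring_nf
    show Complex.exp (-(Complex.I * k) * (t + T : ℝ)) * f (t + T) = _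
    rw [hμf, ← mul_assoc, this]
  · rw [← mul_assoc, ← Complex.exp_add]
    ring_nf
    simp

theorem isBlochForm_of_multiplier {s : DerivSense} {T : ℝ} (hT : 0 < T) {f : ℝ → ℂ}
    (hf : MemCp s 2 f) {μ : ℂ} (hμ : μ ≠ 0) (hμf : ∀ t, f (t + T) = μ * f t) :
    IsBlochForm s T f := by
  obtain ⟨k, hk⟩ := exists_exp_I_mul_eq hT hμ
  obtain ⟨p, hp, hfp⟩ := exists_periodic_factor hf hk hμf
  exact ⟨k, p, hp, hfp⟩

theorem exp_eq_of_quasimomentumClass_eq {T : ℝ} (hT : 0 < T) {k₁ k₂ : ℂ}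
    (h : quasimomentumClass T k₁ = quasimomentumClass T k₂) :
    Complex.exp (Complex.I * k₁ * T) = Complex.exp (Complex.I * k₂ * T) := by
  have hT' : (T : ℂ) ≠ 0 := by exact_mod_cast hT.ne'
  have h1 : k₁ ∈ quasimomentumClass T k₂ := h ▸ ⟨0, by simp⟩
  obtain ⟨m, hm⟩ := h1
  rw [Complex.exp_eq_exp_iff_exists_int]
  refine ⟨m, ?_⟩
  rw [hm]
  field_simp

/-- Floquet's normal forms for a function which the translation by `T` maps, in two steps, to
a combination of the first two translates. -/
theorem floquet_forms {s : DerivSense} {T : ℝ} (hT : 0 < T) {f : ℝ → ℂ} (hf : MemCp s 2 f)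
    (hf0 : f ≠ 0) {a b : ℂ} (hab : ∀ t, f (t + T + T) = a * f (t + T) + b * f t) :
    IsBlochForm s T f ∨ IsGrowthForm s T f ∨ IsTwoBlochForm s T f := by
  have hT' : (T : ℂ) ≠ 0 := by exact_mod_cast hT.ne'
  have hfT : MemCp s 2 (fun t => f (t + T)) := by
    simpa using hf.comp_affine_two one_ne_zero T
  have hne : ∀ μ : ℂ, (∀ t, f (t + T) = μ * f t) → μ ≠ 0 := by
    rintro μ h rfl
    apply hf0
    ext t
    simpa using h (t - T)
  -- With `S` the translation by `T`, the recursion factors as `(S - ν)(S - μ) f = 0` for the roots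
  -- `μ`, `ν` of `X² - aX - b`.
  have step : ∀ μ ν : ℂ, μ + ν = a → μ * ν = -b → ∀ t,
      f (t + T + T) - μ * f (t + T) = ν * (f (t + T) - μ * f t) := by
    intro μ ν h1 h2 t
    rw [hab]
    linear_combination f (t + T) * -h1 + f t * h2
  have mem : ∀ μ : ℂ, MemCp s 2 (fun t => f (t + T) - μ * f t) := by
    intro μ
    have := hfT.add_two (hf.const_mul_two (-μ))
    simpa [sub_eq_add_neg] using this
  have ne : ∀ μ ν : ℂ, μ + ν = a → μ * ν = -b → (¬ ∀ t, f (t + T) - μ * f t = 0) → ν ≠ 0 := by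
    rintro μ ν h1 h2 h rfl
    apply h
    intro t
    simpa using step μ 0 h1 h2 (t - T)
  obtain ⟨μ, hμ⟩ : ∃ μ : ℂ, μ * μ - a * μ - b = 0 := by
    obtain ⟨r, hr⟩ := IsAlgClosed.exists_pow_nat_eq (a ^ 2 + 4 * b) (n := 2) (by norm_num)
    exact ⟨(a + r) / 2, by linear_combination hr / 4⟩
  obtain ⟨ν, hν⟩ : ∃ ν : ℂ, ν = a - μ := ⟨_, rfl⟩
  have h1 : μ + ν = a := by rw [hν]; ring
  have h2 : μ * ν = -b := by rw [hν]; linear_combination -hμ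
  have h1' : ν + μ = a := by rw [add_comm, h1]
  have h2' : ν * μ = -b := by rw [mul_comm, h2]
  by_cases hA : ∀ t, f (t + T) - μ * f t = 0
  · have h : ∀ t, f (t + T) = μ * f t := fun t => sub_eq_zero.1 (hA t)
    exact Or.inl (isBlochForm_of_multiplier hT hf (hne μ h) h)
  by_cases hB : ∀ t, f (t + T) - ν * f t = 0
  · have h : ∀ t, f (t + T) = ν * f t := fun t => sub_eq_zero.1 (hB t)
    exact Or.inl (isBlochForm_of_multiplier hT hf (hne ν h) h)
  have hν0 := ne μ ν h1 h2 hA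
  have hμ0 := ne ν μ h1' h2' hB
  obtain ⟨k, hk⟩ := exists_exp_I_mul_eq hT hμ0
  by_cases hμν : μ = ν
  · subst hμν
    right; left
    -- Double root: `(S - μ) f` is an eigenfunction. Since `S - μ` sends `t e^{ikt} p` to `μ T
    -- e^{ikt} p`, the factor `(μ T)⁻¹` makes `f - t e^{ikt} p` an eigenfunction as well.
    obtain ⟨p, hp, hfp⟩ := exists_periodic_factor ((mem μ).const_mul_two (μ * T)⁻¹) hk (fun t => by
      rw [step μ μ h1 h2]; ring)
    have hpT := hp.2
    have hfp' : ∀ t : ℝ, f (t + T) = μ * f t + μ * T * (Complex.exp (Complex.I * k * t) * p t) := by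
      intro t
      rw [← hfp]
      field_simp
      ring
    have hsplit : ∀ t : ℝ, f t = Complex.exp (Complex.I * k * t) *
        (Complex.exp (-(Complex.I * k) * t) * f t + -1 * ((t : ℂ) * p t) + (t : ℂ) * p t) := by
      intro t
      have : Complex.exp (Complex.I * k * t) * Complex.exp (-(Complex.I * k) * t) = 1 := by
        rw [← Complex.exp_add]
        ring_nf
        simp
      linear_combination -f t * this
    refine ⟨k, fun t => Complex.exp (-(Complex.I * k) * t) * f t + -1 * ((t : ℂ) * p t), p,
      ⟨(hf.exp_mul_two _).add_two (hp.1.ofReal_mul_two.const_mul_two _), fun t => ?_⟩, hp, ?_,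
      hsplit⟩
    · have e1 : Complex.exp (-(Complex.I * k) * (t + T : ℝ)) * μ =
          Complex.exp (-(Complex.I * k) * t) := by
        rw [← hk, ← Complex.exp_add]
        push_cast
        ring_nf
      have e2 : Complex.exp (-(Complex.I * k) * t) * Complex.exp (Complex.I * k * t) = 1 := by
        rw [← Complex.exp_add]
        ring_nf
        simp
      show Complex.exp (-(Complex.I * k) * (t + T : ℝ)) * f (t + T) +
        -1 * (((t + T : ℝ) : ℂ) * p (t + T)) = _
      rw [hpT, hfp']
      push_cast at e1 ⊢
      linear_combination (f t + T * (Complex.exp (Complex.I * k * t) * p t)) * e1 + T * p t * e2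
    -- If `p` vanished, `f` itself would be an eigenfunction, contrary to `hA`.
    · rintro rfl
      apply hA
      intro t
      rw [hfp']
      simp
  · right; right
    obtain ⟨l, hl⟩ := exists_exp_I_mul_eq hT hν0
    have hd : μ - ν ≠ 0 := sub_ne_zero.2 hμν
    -- Distinct roots: `f = ((S - ν) f - (S - μ) f) / (μ - ν)`, a sum of eigenfunctions for `μ` and
    -- `ν`.
    obtain ⟨p, hp, hfp⟩ := exists_periodic_factor ((mem ν).const_mul_two (μ - ν)⁻¹) hk (fun t => by
      rw [step ν μ h1' h2']; ring)
    obtain ⟨q, hq, hfq⟩ := exists_periodic_factor ((mem μ).const_mul_two (-(μ - ν)⁻¹)) hl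
      (fun t => by rw [step μ ν h1 h2]; ring)
    refine ⟨k, l, p, q, fun h => hμν ?_, hp, hq, fun t => ?_⟩
    · rw [← hk, ← hl, exp_eq_of_quasimomentumClass_eq hT h]
    · rw [← hfp, ← hfq]
      field_simp
      ring

/-! ### Uniqueness and recursion for the periodic linear equation. -/

/-- `f` solves `f'' = b f' + q f` in integrated form, with `g = f'`. -/
structure IsODESolution (b : ℂ) (q f g : ℝ → ℂ) : Prop where
  hasDerivAt : ∀ t, HasDerivAt f (g t) t
  continuous_deriv : Continuous g
  sub_eq_integral : ∀ x y, g y - g x = ∫ t in x..y, (b * g t + q t * f t)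

namespace IsODESolution

variable {b : ℂ} {q f g f₁ g₁ f₂ g₂ : ℝ → ℂ}

theorem continuous (H : IsODESolution b q f g) : Continuous f :=
  continuous_iff_continuousAt.2 fun t => (H.hasDerivAt t).continuousAt

theorem intervalIntegrable (hq : LocallyIntegrable q volume) (H : IsODESolution b q f g)
    (x y : ℝ) : IntervalIntegrable (fun t => b * g t + q t * f t) volume x y := by
  have h1 : Continuous fun t => b * g t := H.continuous_deriv.const_mul b
  exact (locallyIntegrable_iff_intervalIntegrable _).1
    (h1.locallyIntegrable.add (LocallyIntegrable.mul_continuous H.continuous hq)) x y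

theorem linearCombination (hq : LocallyIntegrable q volume) (H₁ : IsODESolution b q f₁ g₁)
    (H₂ : IsODESolution b q f₂ g₂) (c₁ c₂ : ℂ) :
    IsODESolution b q (fun t => c₁ * f₁ t + c₂ * f₂ t) (fun t => c₁ * g₁ t + c₂ * g₂ t) where
  hasDerivAt t := ((H₁.hasDerivAt t).const_mul c₁).add ((H₂.hasDerivAt t).const_mul c₂)
  continuous_deriv := (H₁.continuous_deriv.const_mul c₁).add (H₂.continuous_deriv.const_mul c₂)
  sub_eq_integral x y := by
    have e : ∀ t, b * (c₁ * g₁ t + c₂ * g₂ t) + q t * (c₁ * f₁ t + c₂ * f₂ t) =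
        c₁ * (b * g₁ t + q t * f₁ t) + c₂ * (b * g₂ t + q t * f₂ t) := fun t => by ring
    simp_rw [e]
    rw [intervalIntegral.integral_add ((H₁.intervalIntegrable hq x y).const_mul c₁)
      ((H₂.intervalIntegrable hq x y).const_mul c₂), intervalIntegral.integral_const_mul,
      intervalIntegral.integral_const_mul, ← H₁.sub_eq_integral, ← H₂.sub_eq_integral]
    ring

theorem translate {T : ℝ} (hqT : Function.Periodic q T) (H : IsODESolution b q f g) :
    IsODESolution b q (fun t => f (t + T)) (fun t => g (t + T)) where
  hasDerivAt t := (H.hasDerivAt (t + T)).comp_add_const t T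
  continuous_deriv := H.continuous_deriv.comp (continuous_id.add continuous_const)
  sub_eq_integral x y := by
    have := intervalIntegral.integral_comp_add_right (a := x) (b := y)
      (fun t => b * g t + q t * f t) T
    rw [H.sub_eq_integral, ← this]
    refine intervalIntegral.integral_congr fun t _ => ?_
    simp only [hqT t]

open Filter Topology in
-- On a short interval around `t₀`, let `M` be the maximum of `‖f‖ + ‖g‖`. Integrating from `t₀` to
-- a maximum point bounds each of the two norms there by `M / 4`, so `M ≤ M / 2` and `M = 0`.
theorem eventually_eq_zero (hq : LocallyIntegrable q volume) (H : IsODESolution b q f g)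
    {t₀ : ℝ} (hf : f t₀ = 0) (hg : g t₀ = 0) : ∀ᶠ t in 𝓝 t₀, f t = 0 ∧ g t = 0 := by
  -- On the interval `M * K` dominates both `‖g‖` and `‖b g + q f‖`.
  set K : ℝ → ℝ := fun t => 1 + ‖b‖ + ‖q t‖ with hK
  have hKint : ∀ x y, IntervalIntegrable K volume x y := fun x y =>
    intervalIntegrable_const.add ((locallyIntegrable_iff_intervalIntegrable q).1 hq x y).norm
  have hprim : Continuous fun t => |∫ u in t₀..t, K u| :=
    (intervalIntegral.continuous_primitive hKint t₀).abs
  have hsmall : ∀ᶠ t in 𝓝 t₀, |∫ u in t₀..t, K u| < 1 / 4 := by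
    refine hprim.continuousAt.eventually_lt continuousAt_const ?_
    simp
  obtain ⟨δ, hδ, hball⟩ := Metric.eventually_nhds_iff_ball.1 hsmall
  set J : Set ℝ := Set.Icc (t₀ - δ / 2) (t₀ + δ / 2) with hJ
  have ht₀ : t₀ ∈ J := ⟨by linarith, by linarith⟩
  have hm : Continuous fun t => ‖f t‖ + ‖g t‖ := H.continuous.norm.add H.continuous_deriv.norm
  obtain ⟨x, hxJ, hx⟩ := isCompact_Icc.exists_isMaxOn ⟨t₀, ht₀⟩ hm.continuousOn (s := J)
  set M : ℝ := ‖f x‖ + ‖g x‖ with hM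
  have hM0 : 0 ≤ M := by positivity
  have hmax : ∀ t ∈ J, ‖f t‖ + ‖g t‖ ≤ M := fun t ht => hx ht
  have hsub : ∀ t ∈ Set.uIoc t₀ x, t ∈ J := fun t ht =>
    Set.uIcc_subset_Icc ht₀ hxJ (Set.uIoc_subset_uIcc ht)
  have hKM : |∫ u in t₀..x, M * K u| ≤ M * (1 / 4) := by
    rw [intervalIntegral.integral_const_mul, abs_mul, abs_of_nonneg hM0]
    refine mul_le_mul_of_nonneg_left (hball x ?_).le hM0
    rw [Metric.mem_ball, Real.dist_eq, abs_lt]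
    constructor <;> linarith [hxJ.1, hxJ.2]
  have hfx : ‖f x‖ ≤ M * (1 / 4) := by
    have e : f x = ∫ u in t₀..x, g u := by
      rw [intervalIntegral.integral_eq_sub_of_hasDerivAt (fun t _ => H.hasDerivAt t)
        (H.continuous_deriv.intervalIntegrable _ _), hf, sub_zero]
    rw [e]
    refine (intervalIntegral.norm_integral_le_abs_of_norm_le ?_ ((hKint _ _).const_mul M)).trans hKM
    refine (ae_restrict_mem measurableSet_uIoc).mono fun t ht => ?_
    have h1 := hmax t (hsub t ht)
    have h2 : M * 1 ≤ M * K t := by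
      refine mul_le_mul_of_nonneg_left ?_ hM0
      simp only [hK]
      linarith [norm_nonneg b, norm_nonneg (q t)]
    linarith [norm_nonneg (f t)]
  have hgx : ‖g x‖ ≤ M * (1 / 4) := by
    have e : g x = ∫ u in t₀..x, (b * g u + q u * f u) := by
      rw [← H.sub_eq_integral, hg, sub_zero]
    rw [e]
    refine (intervalIntegral.norm_integral_le_abs_of_norm_le ?_ ((hKint _ _).const_mul M)).trans hKM
    refine (ae_restrict_mem measurableSet_uIoc).mono fun t ht => ?_
    have h1 := hmax t (hsub t ht)
    have hfM : ‖f t‖ ≤ M := by linarith [norm_nonneg (g t)]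
    have hgM : ‖g t‖ ≤ M := by linarith [norm_nonneg (f t)]
    calc ‖b * g t + q t * f t‖ ≤ ‖b‖ * ‖g t‖ + ‖q t‖ * ‖f t‖ := by
          refine (norm_add_le _ _).trans ?_
          rw [norm_mul, norm_mul]
      _ ≤ ‖b‖ * M + ‖q t‖ * M := by gcongr
      _ ≤ M * K t := by
          simp only [hK]
          linarith
  have hM' : M = 0 := by linarith
  filter_upwards [Icc_mem_nhds (a := t₀ - δ / 2) (b := t₀ + δ / 2) (by linarith) (by linarith)]
    with t ht
  have h1 := hmax t ht
  constructor
  · exact norm_le_zero_iff.1 (by linarith [norm_nonneg (g t)])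
  · exact norm_le_zero_iff.1 (by linarith [norm_nonneg (f t)])

/-- The common zero set of `f` and `g` is closed, open and nonempty in the connected line. -/
theorem eq_zero (hq : LocallyIntegrable q volume) (H : IsODESolution b q f g)
    {t₀ : ℝ} (hf : f t₀ = 0) (hg : g t₀ = 0) (t : ℝ) : f t = 0 := by
  have hcl : IsClosed {t | f t = 0 ∧ g t = 0} :=
    (isClosed_eq H.continuous continuous_const).inter
      (isClosed_eq H.continuous_deriv continuous_const)
  have hop : IsOpen {t | f t = 0 ∧ g t = 0} :=
    isOpen_iff_mem_nhds.2 fun t ht => H.eventually_eq_zero hq ht.1 ht.2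
  have huniv := IsClopen.eq_univ ⟨hcl, hop⟩ ⟨t₀, hf, hg⟩
  have : t ∈ {t | f t = 0 ∧ g t = 0} := huniv ▸ Set.mem_univ t
  exact this.1

/-- The translates of a solution satisfy a two-step linear recursion. -/
theorem exists_recursion {T : ℝ} (hq : LocallyIntegrable q volume) (hqT : Function.Periodic q T)
    (H : IsODESolution b q f g) (hf0 : f ≠ 0) :
    ∃ c₁ c₀ : ℂ, ∀ t, f (t + T + T) = c₁ * f (t + T) + c₀ * f t := by
  have H₁ := H.translate hqT
  have H₂ := H₁.translate hqT
  -- If the Cauchy data of `f` at `0` and `T` are dependent, then `f (t + T) = c f t`, and a further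
  -- translation gives the recursion with `c₀ = 0`.
  by_cases hdet : f T * g 0 - g T * f 0 = 0
  · have hfg : ¬ (f 0 = 0 ∧ g 0 = 0) := fun h => hf0 (funext (H.eq_zero hq h.1 h.2))
    obtain ⟨c, hc1, hc2⟩ : ∃ c : ℂ, f T = c * f 0 ∧ g T = c * g 0 := by
      by_cases h0 : f 0 = 0
      · have hg0 : g 0 ≠ 0 := fun h => hfg ⟨h0, h⟩
        refine ⟨g T / g 0, ?_, by field_simp⟩
        have : f T * g 0 = 0 := by simpa [h0] using hdet
        simpa [h0, hg0] using this
      · refine ⟨f T / f 0, by field_simp, ?_⟩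
        field_simp
        linear_combination -hdet
    have hz := (H₁.linearCombination hq H 1 (-c)).eq_zero hq (t₀ := 0)
      (by simp [hc1]) (by simp [hc2])
    refine ⟨c, 0, fun t => ?_⟩
    linear_combination hz (t + T)
  -- Cramer's rule: the data at `2T` as a combination of those at `T` and `0`.
  · set c₁ := (f (T + T) * g 0 - g (T + T) * f 0) / (f T * g 0 - g T * f 0) with h1
    set c₀ := (f T * g (T + T) - g T * f (T + T)) / (f T * g 0 - g T * f 0) with h0
    have e1 := div_mul_cancel₀ (f (T + T) * g 0 - g (T + T) * f 0) hdet
    have e0 := div_mul_cancel₀ (f T * g (T + T) - g T * f (T + T)) hdet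
    rw [← h1] at e1
    rw [← h0] at e0
    have hz := ((H₂.linearCombination hq H₁ 1 (-c₁)).linearCombination hq H 1 (-c₀)).eq_zero hq
      (t₀ := 0) (by
        simp only [zero_add]
        refine mul_left_cancel₀ hdet ?_
        linear_combination -f T * e1 - f 0 * e0) (by
        simp only [zero_add]
        refine mul_left_cancel₀ hdet ?_
        linear_combination -g T * e1 - g 0 * e0)
    refine ⟨c₁, c₀, fun t => ?_⟩
    linear_combination hz t

end IsODESolution

/-- A `C_p^2` function satisfying `h = b g + q f` almost everywhere solves the equation in
integrated form. -/
theorem HasCpDerivs.isODESolution {s : DerivSense} {f g h : ℝ → ℂ} {D : Set ℝ}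
    (H : HasCpDerivs s f g h D) {b : ℂ} {q : ℝ → ℂ}
    (heq : ∀ᵐ t : ℝ, h t = b * g t + q t * f t) : IsODESolution b q f g where
  hasDerivAt := H.hasDerivAt
  continuous_deriv := H.continuous_deriv
  sub_eq_integral x y := by
    rw [← intervalIntegral.integral_congr_ae (heq.mono fun t ht _ => ht)]
    exact (integral_eq_of_hasDerivAt_off_countable g h H.locallyFinite.countable
      H.continuous_deriv.continuousOn (fun t ht => H.hasDerivAt_deriv t ht.2)
      ((locallyIntegrable_iff_intervalIntegrable h).1 H.locallyIntegrable x y)).symm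

/-! ### Second derivatives of products of functions of linear coordinates. -/

section Product

variable {W : Type*} [NormedAddCommGroup W] [NormedSpace ℝ W]

/-- `F` is differentiable, and its derivative is differentiable at `r`. -/
def IsTwiceDifferentiableAt (F : W → ℂ) (r : W) : Prop :=
  Differentiable ℝ F ∧ DifferentiableAt ℝ (fderiv ℝ F) r

theorem fderiv_fun_mul_eq {F G : W → ℂ} (hF : Differentiable ℝ F) (hG : Differentiable ℝ G) :
    fderiv ℝ (fun x => F x * G x) = fun x => F x • fderiv ℝ G x + G x • fderiv ℝ F x :=
  funext fun x => ((hF x).hasFDerivAt.mul (hG x).hasFDerivAt).fderiv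

theorem IsTwiceDifferentiableAt.mul {F G : W → ℂ} {r : W} (hF : IsTwiceDifferentiableAt F r)
    (hG : IsTwiceDifferentiableAt G r) : IsTwiceDifferentiableAt (fun x => F x * G x) r := by
  refine ⟨hF.1.mul hG.1, ?_⟩
  rw [fderiv_fun_mul_eq hF.1 hG.1]
  exact ((hF.1 r).smul hG.2).add ((hG.1 r).smul hF.2)

theorem IsTwiceDifferentiableAt.prod {ι : Type*} (u : Finset ι) {F : ι → W → ℂ} {r : W}
    (h : ∀ i ∈ u, IsTwiceDifferentiableAt (F i) r) :
    IsTwiceDifferentiableAt (fun x => ∏ i ∈ u, F i x) r := by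
  classical
  induction u using Finset.induction_on with
  | empty => exact ⟨by simp, by simp⟩
  | insert i u hi ih =>
    simp_rw [Finset.prod_insert hi]
    exact (h i (Finset.mem_insert_self i u)).mul
      (ih fun k hk => h k (Finset.mem_insert_of_mem hk))

theorem fderiv_fderiv_mul_apply {F G : W → ℂ} {r : W} (hF : IsTwiceDifferentiableAt F r)
    (hG : IsTwiceDifferentiableAt G r) (v : W) :
    fderiv ℝ (fderiv ℝ (fun x => F x * G x)) r v v =
      F r * fderiv ℝ (fderiv ℝ G) r v v + 2 * (fderiv ℝ F r v * fderiv ℝ G r v) +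
        G r * fderiv ℝ (fderiv ℝ F) r v v := by
  have h := ((hF.1 r).hasFDerivAt.smul hG.2.hasFDerivAt).add
    ((hG.1 r).hasFDerivAt.smul hF.2.hasFDerivAt)
  rw [fderiv_fun_mul_eq hF.1 hG.1]
  have h' := h.fderiv
  simp only [Pi.smul_apply', Pi.add_def] at h'
  rw [h']
  simp only [add_apply, smul_apply,
    ContinuousLinearMap.smulRight_apply, smul_eq_mul]
  ring

theorem HasCpDerivs.fderiv_comp {s : DerivSense} {f g h : ℝ → ℂ} {D : Set ℝ}
    (H : HasCpDerivs s f g h D) (l : W →L[ℝ] ℝ) :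
    fderiv ℝ (fun x => f (l x)) = fun x => g (l x) • Complex.ofRealCLM.comp l := by
  ext x v
  have h1 := ((H.hasDerivAt (l x)).hasFDerivAt.comp x l.hasFDerivAt).fderiv
  simp only [Function.comp_def] at h1
  rw [h1]
  simp [mul_comm]

theorem HasCpDerivs.isTwiceDifferentiableAt_comp {s : DerivSense} {f g h : ℝ → ℂ} {D : Set ℝ}
    (H : HasCpDerivs s f g h D) (l : W →L[ℝ] ℝ) {r : W} (hr : l r ∉ D) :
    IsTwiceDifferentiableAt (fun x => f (l x)) r := by
  refine ⟨fun x => (H.hasDerivAt (l x)).differentiableAt.comp x l.differentiableAt, ?_⟩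
  rw [H.fderiv_comp l]
  exact ((H.hasDerivAt_deriv _ hr).differentiableAt.comp r l.differentiableAt).smul_const _

theorem HasCpDerivs.fderiv_fderiv_comp_apply {s : DerivSense} {f g h : ℝ → ℂ} {D : Set ℝ}
    (H : HasCpDerivs s f g h D) (l : W →L[ℝ] ℝ) {r : W} (hr : l r ∉ D) (v : W) :
    fderiv ℝ (fderiv ℝ (fun x => f (l x))) r v v = h (l r) * (l v : ℂ) ^ 2 := by
  have h1 := ((H.hasDerivAt_deriv _ hr).hasFDerivAt.comp r l.hasFDerivAt).smul_const
    (Complex.ofRealCLM.comp l)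
  rw [H.fderiv_comp l]
  have h2 := h1.fderiv
  simp only [Function.comp_def] at h2
  rw [h2]
  simp
  ring

/-- The general codomain allows iteration: invariance passes from a function to its derivative and
then to its second derivative. -/
theorem fderiv_add_eq_of_invariant {N : Type*} [NormedAddCommGroup N] [NormedSpace ℝ N]
    {G : W → N} {a : W} (h : ∀ x, G (x + a) = G x) (x : W) :
    fderiv ℝ G (x + a) = fderiv ℝ G x := by
  rw [← fderiv_comp_add_right a]
  simp_rw [h]

end Product

theorem laplacian_eq_sum_fderiv {d : ℕ} (F : EuclideanSpace ℝ (Fin d) → ℂ)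
    (r : EuclideanSpace ℝ (Fin d)) :
    (Δ F) r = ∑ i, fderiv ℝ (fderiv ℝ F) r (EuclideanSpace.basisFun (Fin d) ℝ i)
      (EuclideanSpace.basisFun (Fin d) ℝ i) := by
  rw [InnerProductSpace.laplacian_eq_iteratedFDeriv_orthonormalBasis F
    (EuclideanSpace.basisFun (Fin d) ℝ)]
  simp [iteratedFDeriv_two_apply]

/-! ### Coordinates along the primitive vectors. -/

section Coords

variable {d : ℕ} {γ : Fin d → EuclideanSpace ℝ (Fin d)}

/-- The basis of primitive vectors. -/
noncomputable def latticeBasis (hγ : LinearIndependent ℝ γ) :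
    Module.Basis (Fin d) ℝ (EuclideanSpace ℝ (Fin d)) :=
  basisOfLinearIndependentOfCardEqFinrank' γ hγ (by simp)

theorem latticeBasis_apply (hγ : LinearIndependent ℝ γ) (j : Fin d) :
    latticeBasis hγ j = γ j := by
  simp [latticeBasis]

/-- The coordinate along the normalized primitive vector `γ_j / ‖γ_j‖`. -/
noncomputable def latticeCoord (hγ : LinearIndependent ℝ γ) (j : Fin d) :
    EuclideanSpace ℝ (Fin d) →L[ℝ] ℝ :=
  ‖γ j‖ • LinearMap.toContinuousLinearMap ((latticeBasis hγ).coord j)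

theorem norm_primitive_pos (hγ : LinearIndependent ℝ γ) (j : Fin d) : 0 < ‖γ j‖ :=
  norm_pos_iff.2 (hγ.ne_zero j)

theorem ofLatticeCoords_latticeCoord (hγ : LinearIndependent ℝ γ)
    (r : EuclideanSpace ℝ (Fin d)) : ofLatticeCoords γ (fun j => latticeCoord hγ j r) = r := by
  conv_rhs => rw [← (latticeBasis hγ).sum_repr r]
  refine Finset.sum_congr rfl fun j _ => ?_
  have := (norm_primitive_pos hγ j).ne'
  rw [smul_smul, latticeBasis_apply]
  congr 1
  simp [latticeCoord]
  field_simp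

theorem latticeCoord_self (hγ : LinearIndependent ℝ γ) (j : Fin d) :
    latticeCoord hγ j (γ j) = ‖γ j‖ := by
  conv_lhs => rw [← latticeBasis_apply hγ j]
  simp [latticeCoord]

theorem latticeCoord_of_ne (hγ : LinearIndependent ℝ γ) {j k : Fin d} (h : k ≠ j) :
    latticeCoord hγ k (γ j) = 0 := by
  conv_lhs => rw [← latticeBasis_apply hγ j]
  simp [latticeCoord, h.symm]

theorem IsSeparatedBy.eq_prod (hγ : LinearIndependent ℝ γ) {Ψ : EuclideanSpace ℝ (Fin d) → ℂ}
    {ψ : Fin d → ℝ → ℂ} (h : IsSeparatedBy γ Ψ ψ) :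
    Ψ = fun r => ∏ k, ψ k (latticeCoord hγ k r) := by
  ext r
  conv_lhs => rw [← ofLatticeCoords_latticeCoord hγ r]
  exact h _

/-- Along the line in direction `γ j` through a point where `Ψ ≠ 0`, the other factors form a
nonzero constant; divide by it and rescale the parameter. -/
theorem IsSeparatedBy.memCp_two {s : DerivSense} (hγ : LinearIndependent ℝ γ)
    {Ψ : EuclideanSpace ℝ (Fin d) → ℂ} (hΨ : MemTensorCp γ s 2 Ψ) (hΨ0 : Ψ ≠ 0)
    {ψ : Fin d → ℝ → ℂ} (h : IsSeparatedBy γ Ψ ψ) (j : Fin d) : MemCp s 2 (ψ j) := by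
  obtain ⟨r, hr⟩ := Function.ne_iff.1 hΨ0
  have hp := h.eq_prod hγ
  set T := ‖γ j‖ with hTdef
  have hT : T ≠ 0 := (norm_primitive_pos hγ j).ne'
  set c := ∏ k ∈ Finset.univ.erase j, ψ k (latticeCoord hγ k r) with hc
  have hc0 : c ≠ 0 := by
    intro h0
    apply hr
    rw [hp]
    simp only [← Finset.mul_prod_erase Finset.univ _ (Finset.mem_univ j), ← hc, h0, mul_zero,
      Pi.zero_apply]
  have key : ∀ t, Ψ (r + t • γ j) = ψ j (latticeCoord hγ j r + t * T) * c := by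
    intro t
    rw [hp]
    simp only [← Finset.mul_prod_erase Finset.univ _ (Finset.mem_univ j)]
    congr 1
    · rw [map_add, map_smul, latticeCoord_self, smul_eq_mul]
    · refine Finset.prod_congr rfl fun k hk => ?_
      rw [map_add, map_smul, latticeCoord_of_ne hγ (Finset.ne_of_mem_erase hk), smul_zero, add_zero]
  have h1 := ((hΨ j r).comp_affine_two (inv_ne_zero hT)
    (-(T⁻¹ * latticeCoord hγ j r))).const_mul_two c⁻¹
  convert! h1 using 1
  ext u
  have e : latticeCoord hγ j r + (T⁻¹ * u + -(T⁻¹ * latticeCoord hγ j r)) * T = u := by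
    field_simp
    ring
  rw [key, e]
  field_simp

end Coords

/-! ### Reduction to one variable and conclusion. -/

/-- The factors of a separable solution solve a linear ordinary differential equation with constant
first-order coefficient and periodic, locally integrable potential. -/
theorem IsSeparatedBy.exists_isODESolution {s : DerivSense} {d : ℕ}
    {γ : Fin d → EuclideanSpace ℝ (Fin d)} (hγ : LinearIndependent ℝ γ)
    {V : EuclideanSpace ℝ (Fin d) → ℂ} (hVper : IsLatticePeriodic γ V) (hV : MemTensorCp γ s 0 V)
    {E : ℂ} {Ψ : EuclideanSpace ℝ (Fin d) → ℂ} (hΨ : MemTensorCp γ s 2 Ψ) (hΨ0 : Ψ ≠ 0)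
    (hsol : IsSchrodingerSolution V E Ψ) {ψ : Fin d → ℝ → ℂ} (hsep : IsSeparatedBy γ Ψ ψ)
    (j : Fin d) : ψ j ≠ 0 ∧ ∃ (b : ℂ) (q g : ℝ → ℂ), LocallyIntegrable q volume ∧
      Function.Periodic q ‖γ j‖ ∧ IsODESolution b q (ψ j) g := by
  have hmem := fun k => memCp_two_iff.1 (hsep.memCp_two hγ hΨ hΨ0 k)
  choose g h D H using hmem
  have hp := hsep.eq_prod hγ
  set l := latticeCoord hγ with hl
  set T := ‖γ j‖ with hTdef
  have hT : T ≠ 0 := (norm_primitive_pos hγ j).ne'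
  set e := T⁻¹ • γ j with he
  have hle : l j e = 1 := by
    rw [he, map_smul, hl, latticeCoord_self, smul_eq_mul, inv_mul_cancel₀ hT]
  have hle' : ∀ k, k ≠ j → l k e = 0 := fun k hk => by
    rw [he, map_smul, hl, latticeCoord_of_ne hγ hk, smul_zero]
  -- The preimage of a countable set under a nonzero linear functional is null.
  have hcoord : ∀ k, ∀ᵐ r ∂(volume : Measure (EuclideanSpace ℝ (Fin d))), l k r ∉ D k := by
    intro k
    have hsurj : Function.Surjective (l k).toLinearMap := by
      intro x
      refine ⟨(x * ‖γ k‖⁻¹) • γ k, ?_⟩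
      have := (norm_primitive_pos hγ k).ne'
      simp only [ContinuousLinearMap.coe_coe, map_smul, hl, latticeCoord_self, smul_eq_mul]
      field_simp
    have hcount := (H k).locallyFinite.countable
    exact (ae_comp_linearMap_mem_iff (l k).toLinearMap volume volume hsurj
      hcount.measurableSet.compl).2 (hcount.ae_notMem volume)
  have hae : ∀ᵐ r ∂(volume : Measure (EuclideanSpace ℝ (Fin d))),
      (-(1 / 2 : ℂ) * (Δ Ψ) r + V r * Ψ r = E * Ψ r) ∧ ∀ k, l k r ∉ D k :=
    Filter.Eventually.and hsol (ae_all_iff.2 hcoord)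
  obtain ⟨S, hS, hSm, hSp⟩ := hae.exists_measurable_mem
  -- Fubini: almost every line in direction `e` lies in `S` for almost every parameter.
  have hline := (ae_ae_add_linearMap_mem_iff (LinearMap.toSpanSingleton ℝ _ e) volume
    (volume : Measure (EuclideanSpace ℝ (Fin d))) hSm).2 hS
  have hcont : Continuous Ψ := by
    rw [hp]
    exact continuous_finsetProd _ fun k _ => (H k).continuous.comp (l k).continuous
  -- A set of full measure is dense, so it meets the nonempty open set where `Ψ ≠ 0`.
  obtain ⟨r₀, hr₀ae, hr₀⟩ := (Measure.dense_of_ae hline).exists_mem_open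
    (isOpen_ne_fun hcont continuous_const) (Function.ne_iff.1 hΨ0)
  set G : EuclideanSpace ℝ (Fin d) → ℂ := fun r => ∏ k ∈ Finset.univ.erase j, ψ k (l k r) with hG
  have hΨG : ∀ r, Ψ r = ψ j (l j r) * G r := fun r => by
    rw [hp]
    exact (Finset.mul_prod_erase Finset.univ _ (Finset.mem_univ j)).symm
  have hΨG' : Ψ = fun r => ψ j (l j r) * G r := funext hΨG
  have hGinv : ∀ (t : ℝ) r, G (r + t • e) = G r := by
    intro t r
    refine Finset.prod_congr rfl fun k hk => ?_
    rw [map_add, map_smul, hle' k (Finset.ne_of_mem_erase hk), smul_zero, add_zero]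
  have hG1 : ∀ (t : ℝ) r, fderiv ℝ G (r + t • e) = fderiv ℝ G r := fun t =>
    fderiv_add_eq_of_invariant (hGinv t)
  have hG2 : ∀ (t : ℝ) r, fderiv ℝ (fderiv ℝ G) (r + t • e) = fderiv ℝ (fderiv ℝ G) r := fun t =>
    fderiv_add_eq_of_invariant (hG1 t)
  have hr₀' : ψ j (l j r₀) * G r₀ ≠ 0 := hΨG r₀ ▸ hr₀
  have hψ0 : ψ j ≠ 0 := fun h0 => left_ne_zero_of_mul hr₀' (by rw [h0, Pi.zero_apply])
  have hG0 : G r₀ ≠ 0 := right_ne_zero_of_mul hr₀'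
  let v := EuclideanSpace.basisFun (Fin d) ℝ
  obtain ⟨α, hα⟩ : ∃ α : ℝ, α = ∑ i, l j (v i) ^ 2 := ⟨_, rfl⟩
  obtain ⟨κ, hκ⟩ : ∃ κ : ℂ, κ = ∑ i, (l j (v i) : ℂ) * fderiv ℝ G r₀ (v i) := ⟨_, rfl⟩
  obtain ⟨δ, hδ⟩ : ∃ δ : ℂ, δ = ∑ i, fderiv ℝ (fderiv ℝ G) r₀ (v i) (v i) := ⟨_, rfl⟩
  have hα0 : (α : ℂ) ≠ 0 := by
    rw [Complex.ofReal_ne_zero]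
    intro h0
    rw [hα, Finset.sum_eq_zero_iff_of_nonneg fun i _ => sq_nonneg _] at h0
    have hz : (l j).toLinearMap = 0 := v.toBasis.ext fun i => by
      simpa using h0 i (Finset.mem_univ i)
    have : l j e = 0 := by simpa using LinearMap.congr_fun hz e
    rw [hle] at this
    exact one_ne_zero this
  have hlap : ∀ r, (∃ t : ℝ, r = r₀ + t • e) → (∀ k, l k r ∉ D k) → (Δ Ψ) r =
      ψ j (l j r) * δ + 2 * κ * g j (l j r) + G r₀ * α * h j (l j r) := by
    rintro r ⟨t, hrt⟩ hr
    have hF := (H j).isTwiceDifferentiableAt_comp (l j) (hr j)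
    have hGd : IsTwiceDifferentiableAt G r :=
      .prod _ fun k _ => (H k).isTwiceDifferentiableAt_comp (l k) (hr k)
    have hdF : ∀ w, fderiv ℝ (fun x => ψ j (l j x)) r w = g j (l j r) * l j w := fun w => by
      rw [(H j).fderiv_comp (l j)]
      rfl
    rw [laplacian_eq_sum_fderiv, hΨG']
    simp_rw [fderiv_fderiv_mul_apply hF hGd, (H j).fderiv_fderiv_comp_apply (l j) (hr j),
      hdF]
    rw [hrt, hGinv, hG1, hG2, ← hrt, hα, hκ, hδ]
    push_cast
    simp only [Finset.sum_add_distrib, Finset.mul_sum, Finset.sum_mul]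
    congr 1
    · congr 1
      exact Finset.sum_congr rfl fun i _ => by ring
    · exact Finset.sum_congr rfl fun i _ => by ring
  -- Shifting the parameter makes it equal to the coordinate `l j`.
  have hshift : ∀ᵐ t : ℝ, r₀ + (t - l j r₀) • e ∈ S :=
    (measurePreserving_sub_right volume (l j r₀)).quasiMeasurePreserving.ae hr₀ae
  -- The coefficients come from dividing the restricted equation by `-(1/2) * G r₀ * α`.
  refine ⟨hψ0, -(2 * κ / (G r₀ * α)),
    fun t => 2 / α * V (r₀ + (t - l j r₀) • e) + (-(2 * E / α) - δ / (G r₀ * α)), g j, ?_, ?_,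
    (H j).isODESolution ?_⟩
  · have h1 := (hV j r₀).2.comp_affine (inv_ne_zero hT) (-(T⁻¹ * l j r₀))
    have h2 : ∀ t : ℝ, (T⁻¹ * t + -(T⁻¹ * l j r₀)) • γ j = (t - l j r₀) • e := fun t => by
      rw [he, smul_smul]
      congr 1
      ring
    simp_rw [h2] at h1
    exact (h1.smul (2 / α : ℂ)).add continuous_const.locallyIntegrable
  · intro t
    have h1 : r₀ + (t + T - l j r₀) • e = r₀ + (t - l j r₀) • e + γ j := by
      have : T • e = γ j := by rw [he, smul_inv_smul₀ hT]
      rw [← this]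
      module
    show 2 / α * V (r₀ + (t + T - l j r₀) • e) + _ = _
    rw [h1, hVper _ (Submodule.subset_span (Set.mem_range_self j))]
  · filter_upwards [hshift] with t ht
    obtain ⟨h1, h2⟩ := hSp _ ht
    have h3 : l j (r₀ + (t - l j r₀) • e) = t := by
      rw [map_add, map_smul, hle, smul_eq_mul]
      ring
    rw [hlap _ ⟨_, rfl⟩ h2, hΨG, h3, hGinv] at h1
    field_simp
    linear_combination (-2) * h1

theorem mainTheorem5 (s : DerivSense) {d : ℕ} (γ : Fin d → EuclideanSpace ℝ (Fin d))
    (hγ : LinearIndependent ℝ γ)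
    (V : EuclideanSpace ℝ (Fin d) → ℂ) (hVper : IsLatticePeriodic γ V)
    (hV : MemTensorCp γ s 0 V)
    (E : ℂ) (Ψ : EuclideanSpace ℝ (Fin d) → ℂ) (hΨ : MemTensorCp γ s 2 Ψ) (hΨ0 : Ψ ≠ 0)
    (hsol : IsSchrodingerSolution V E Ψ)
    (ψ : Fin d → ℝ → ℂ) (hsep : IsSeparatedBy γ Ψ ψ) :
    ∀ j : Fin d, IsBlochForm s ‖γ j‖ (ψ j) ∨ IsGrowthForm s ‖γ j‖ (ψ j) ∨
      IsTwoBlochForm s ‖γ j‖ (ψ j) := by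
  intro j
  obtain ⟨hψ0, b, q, g, hq, hqT, hode⟩ :=
    hsep.exists_isODESolution hγ hVper hV hΨ hΨ0 hsol j
  obtain ⟨c₁, c₀, hrec⟩ := hode.exists_recursion hq hqT hψ0
  exact floquet_forms (norm_primitive_pos hγ j) (hsep.memCp_two hγ hΨ hΨ0 j) hψ0 hrec
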